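/- Let $F(a,b;c;z)$ denote the principal branch of the Gauss hypergeometric function, that is, the analytic continuation to $\mathbb{C}\setminus[1,\infty)$ of $\sum_{n\ge 0}\frac{(a)_n(b)_n}{(c)_n\,n!}z^n$ $(|z|<1)$, and let $\psi(s)=\Gamma'(s)/\Gamma(s)$ be the logarithmic derivative of the Gamma function. Then, for $r\gg 1$ and uniformly in $y>0$, $$\frac{\Gamma^2\left(\tfrac12+ir\right)}{\Gamma(1+2ir)}\,F\left(\tfrac12+ir,\tfrac12+ir;1+2ir;-y\right)=y^{-1/2-ir}\left(\log y+2\psi(1)-2\psi\left(\tfrac12+ir\right)\right)+O\left(\frac{r}{y}\right).$$ Explicitly: for every $r_0>0$ there is a constant $C>0$, depending only on $r_0$, such that for all real $r\ge r_0$ and all real $y>0$ the difference between the left-hand side and the main term $y^{-1/2-ir}\left(\log y+2\psi(1)-2\psi\left(\tfrac12+ir\right)\right)$ is at most $C\,r/y$ in absolute value. -/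

import Mathlib

/-- The complex plane cut along the real half-line `[1, ∞)`:
`1 - z` is not a real number `≤ 0`. -/
def cutPlane : Set ℂ := {z : ℂ | 1 - z ∈ Complex.slitPlane}

/-- `G` is holomorphic on `ℂ \ [1, ∞)` and equals the sum of Gauss's series
`∑ (a)ₙ (b)ₙ / ((c)ₙ n!) zⁿ` for `|z| < 1`. -/
def IsGaussContinuation (a b c : ℂ) (G : ℂ → ℂ) : Prop :=
  DifferentiableOn ℂ G cutPlane ∧ Set.EqOn G (ordinaryHypergeometric a b c) (Metric.ball 0 1)

/-- The continuation is unique. -/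
theorem IsGaussContinuation.eqOn {a b c : ℂ} {G H : ℂ → ℂ} (hG : IsGaussContinuation a b c G)
    (hH : IsGaussContinuation a b c H) : Set.EqOn G H cutPlane := by
  have hopen : IsOpen cutPlane :=
    Complex.isOpen_slitPlane.preimage (continuous_const.sub continuous_id)
  have hconn : IsPreconnected cutPlane := by
    have h : cutPlane = (fun w : ℂ => 1 - w) '' Complex.slitPlane := by
      ext z
      constructor
      · intro hz
        exact ⟨1 - z, hz, by ring⟩
      · rintro ⟨w, hw, rfl⟩
        simpa [cutPlane] using hw
    rw [h]
    exact (Complex.starConvex_one_slitPlane.isPathConnected (by simp)).isConnected.isPreconnected.image _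
      (continuous_const.sub continuous_id).continuousOn
  refine (hG.1.analyticOnNhd hopen).eqOn_of_preconnected_of_eventuallyEq
    (hH.1.analyticOnNhd hopen) hconn (z₀ := 0) (by simp [cutPlane]) ?_
  filter_upwards [Metric.ball_mem_nhds (0 : ℂ) one_pos] with z hz
  rw [hG.2 hz, hH.2 hz]

open Classical in
/-- The principal branch of the Gauss hypergeometric function `F(a, b; c; z)`, `z ∉ [1, ∞)`: the
analytic continuation to `ℂ \ [1, ∞)` of the sum of Gauss's series. -/
noncomputable def gaussF (a b c : ℂ) : ℂ → ℂ :=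
  if h : ∃ G : ℂ → ℂ, IsGaussContinuation a b c G then h.choose else ordinaryHypergeometric a b c

/-! Put `a = 1/2 + ir` and `x = 1/y`. The Gamma quotient is `B(a, a)`, so the left side is Euler's
integral for `F(a, a; 2a; -y)`, valid on the whole cut plane by uniqueness of continuation. The
substitution `t = p / (p + 1 + x)` turns it into `x ^ a ∫₀^∞ A(p) ^ (-a) dp / p` with `A(p) = 1 + 2x
+ p + x(1 + x)/p` (`eulerIntegral_eq_integral_laplaceKernel`).

The involution `p ↦ x(1 + x)/p` fixes `A` and `dp / p`, so the integral is twice its part over `p >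
b = √(x(1 + x))`. There `A(p)` is close to `1 + p`, and `∫_b^∞ (1 + p) ^ (-a) dp / p` is
approximately `-log b - (ψ(a) - ψ(1))` by Dirichlet's integral (`integral_dirichletKernel`).
Doubling gives `log y + 2ψ(1) - 2ψ(a)`. For `x ≤ 1` every error is `O((1 + |a|)√x)`; for `x ≥ 1`
this bound holds trivially, term by term (`norm_laplace_integral_add_log_le`). The prefactor `|x ^
a| = √x` then yields `O(r x) = O(r / y)`. -/

/-! ### Euler's integral as the analytic continuation. -/

theorem gaussF_eqOn {a b c : ℂ} {G : ℂ → ℂ} (hG : IsGaussContinuation a b c G) :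
    Set.EqOn (gaussF a b c) G cutPlane := by
  have h : ∃ G : ℂ → ℂ, IsGaussContinuation a b c G := ⟨G, hG⟩
  rw [gaussF, dif_pos h]
  exact h.choose_spec.eqOn hG

/-- The slit plane is star-shaped about `1`, and `1 - z t` is the convex combination of `1` and `1 -
z`. This keeps the base in Euler's integral off the branch cut. -/
theorem one_sub_mul_mem_slitPlane {z : ℂ} (hz : z ∈ cutPlane) {t : ℝ} (ht : t ∈ Set.Icc (0 : ℝ) 1) :
    1 - z * t ∈ Complex.slitPlane := by
  have h := Complex.starConvex_one_slitPlane hz (sub_nonneg.2 ht.2) ht.1 (by ring)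
  convert h using 1
  simp only [Complex.real_smul]
  push_cast
  ring

theorem isOpen_cutPlane : IsOpen cutPlane :=
  Complex.isOpen_slitPlane.preimage (continuous_const.sub continuous_id)

/-- The binomial series, with its coefficients written as rising factorials. -/
theorem hasSum_one_sub_cpow_neg (a : ℂ) {z : ℂ} (hz : ‖z‖ < 1) :
    HasSum (fun n : ℕ => ((n.factorial : ℂ)⁻¹ * (ascPochhammer ℂ n).eval a) * z ^ n)
      ((1 - z) ^ (-a)) ∧
    Summable (fun n : ℕ => ‖((n.factorial : ℂ)⁻¹ * (ascPochhammer ℂ n).eval a) * z ^ n‖) := by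
  have hcoe : ∀ n : ℕ, Ring.choose (a + n - 1) n
      = (n.factorial : ℂ)⁻¹ * (ascPochhammer ℂ n).eval a := by
    intro n
    have h := Ring.factorial_nsmul_multichoose_eq_ascPochhammer a n
    have h2 : (a + n - 1 : ℂ) - n + 1 = a := by ring
    rw [Ring.choose, h2, eq_inv_mul_iff_mul_eq₀ (by exact_mod_cast n.factorial_ne_zero),
      ← nsmul_eq_mul, h, Polynomial.ascPochhammer_smeval_eq_eval]
  have hp := Complex.one_div_one_sub_cpow_hasFPowerSeriesOnBall_zero a
  have hz' : z ∈ Metric.eball (0 : ℂ) 1 := by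
    rw [← ENNReal.ofReal_one, Metric.eball_ofReal]; simpa using hz
  constructor
  · have := hp.hasSum hz'
    simpa [FormalMultilinearSeries.ofScalars, List.prod_ofFn, hcoe, Complex.cpow_neg, mul_comm,
      mul_left_comm, mul_assoc] using this
  · have := FormalMultilinearSeries.summable_norm_apply _ (Metric.eball_subset_eball hp.r_le hz')
    simpa [FormalMultilinearSeries.ofScalars, List.prod_ofFn, hcoe, mul_comm,
      mul_left_comm, mul_assoc] using this

/-- Euler's integral `∫₀¹ t ^ (b - 1) (1 - t) ^ (c - b - 1) (1 - z t) ^ (-a) dt`. -/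
noncomputable def eulerIntegral (a b c z : ℂ) : ℂ :=
  ∫ t : ℝ in 0..1, ((t : ℂ) ^ (b - 1) * (1 - (t : ℂ)) ^ (c - b - 1)) * (1 - z * t) ^ (-a)

theorem continuousOn_one_sub_mul_cpow (s : ℂ) {z : ℂ} (hz : z ∈ cutPlane) :
    ContinuousOn (fun t : ℝ => (1 - z * t) ^ s) (Set.Icc 0 1) :=
  ContinuousOn.cpow_const (by fun_prop) fun _ ht => one_sub_mul_mem_slitPlane hz ht

/-- Binomial expansion of `(1 - z t) ^ (-a)`, integrated termwise; since `0 < t ≤ 1`, the Beta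
weight times the absolute series at `z` dominates. -/
theorem hasSum_eulerIntegral (a : ℂ) {b c z : ℂ} (hb : 0 < b.re) (hbc : b.re < c.re)
    (hz : ‖z‖ < 1) :
    HasSum (fun n : ℕ => ((n.factorial : ℂ)⁻¹ * (ascPochhammer ℂ n).eval a) * z ^ n *
      Complex.betaIntegral (b + n) (c - b)) (eulerIntegral a b c z) := by
  have hcb : 0 < (c - b).re := by simpa using hbc
  have hw := Complex.betaIntegral_convergent hb hcb
  set k : ℕ → ℂ := fun n => ((n.factorial : ℂ)⁻¹ * (ascPochhammer ℂ n).eval a) * z ^ n with hk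
  have hsum := (hasSum_one_sub_cpow_neg a hz).2
  have key := intervalIntegral.hasSum_integral_of_dominated_convergence (a := 0) (b := 1)
    (μ := MeasureTheory.volume)
    (F := fun (n : ℕ) (t : ℝ) =>
      ((t : ℂ) ^ (b - 1) * (1 - (t : ℂ)) ^ (c - b - 1)) * (k n * (t : ℂ) ^ n))
    (f := fun t : ℝ =>
      ((t : ℂ) ^ (b - 1) * (1 - (t : ℂ)) ^ (c - b - 1)) * (1 - z * t) ^ (-a))
    (bound := fun n t => ‖(t : ℂ) ^ (b - 1) * (1 - (t : ℂ)) ^ (c - b - 1)‖ * ‖k n‖)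
    (fun n => ?_) (fun n => ?_) ?_ ?_ ?_
  · refine key.congr_fun fun n => ?_
    rw [Complex.betaIntegral, ← intervalIntegral.integral_const_mul]
    refine intervalIntegral.integral_congr_ae (Filter.Eventually.of_forall fun t ht => ?_)
    rw [Set.uIoc_of_le zero_le_one] at ht
    have ht0 : (t : ℂ) ≠ 0 := by exact_mod_cast ht.1.ne'
    rw [show b + n - 1 = (b - 1) + n by ring, Complex.cpow_add _ _ ht0, Complex.cpow_natCast]
    ring
  · exact (hw.mul_continuousOn (by fun_prop)).def'.aestronglyMeasurable
  · refine Filter.Eventually.of_forall fun t ht => ?_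
    rw [Set.uIoc_of_le zero_le_one] at ht
    rw [norm_mul, norm_mul (k n), norm_pow, Complex.norm_real, Real.norm_of_nonneg ht.1.le]
    gcongr
    exact mul_le_of_le_one_right (norm_nonneg _) (pow_le_one₀ ht.1.le ht.2)
  · exact Filter.Eventually.of_forall fun t _ => hsum.mul_left _
  · simp_rw [tsum_mul_left]
    exact hw.norm.mul_const _
  · refine Filter.Eventually.of_forall fun t ht => ?_
    rw [Set.uIoc_of_le zero_le_one] at ht
    have hzt : ‖z * t‖ < 1 := by
      rw [norm_mul, Complex.norm_real, Real.norm_of_nonneg ht.1.le]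
      exact (mul_le_of_le_one_right (norm_nonneg _) ht.2).trans_lt hz
    have := (hasSum_one_sub_cpow_neg a hzt).1
    refine HasSum.mul_left _ ?_
    refine this.congr_fun fun n => ?_
    rw [hk]; dsimp only
    rw [mul_pow]; ring

theorem betaIntegral_add_nat_left {u v : ℂ} (hu : 0 < u.re) (hv : 0 < v.re) (n : ℕ) :
    Complex.betaIntegral (u + n) v = (ascPochhammer ℂ n).eval u *
      ((ascPochhammer ℂ n).eval (u + v))⁻¹ * Complex.betaIntegral u v := by
  have huv : 0 < (u + v).re := by simpa using add_pos hu hv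
  have ne : ∀ {s : ℂ}, 0 < s.re → ∀ m : ℕ, s ≠ -m := by
    intro s hs m h
    rw [h] at hs
    simp at hs
    linarith [(Nat.cast_nonneg m : (0 : ℝ) ≤ m)]
  have hun : 0 < (u + n).re := by simp; positivity
  have huvn : 0 < (u + v + n).re := by
    have : (0 : ℝ) ≤ n := Nat.cast_nonneg n
    simp at huv ⊢; linarith
  rw [Complex.betaIntegral_eq_Gamma_mul_div _ _ hun hv,
    Complex.betaIntegral_eq_Gamma_mul_div _ _ hu hv,
    ← Complex.Gamma_add_nat_div_Gamma_eq u (ne hu),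
    ← Complex.Gamma_add_nat_div_Gamma_eq (u + v) (ne huv), add_right_comm]
  have h1 := Complex.Gamma_ne_zero_of_re_pos hu
  have h2 := Complex.Gamma_ne_zero_of_re_pos huv
  have h3 := Complex.Gamma_ne_zero_of_re_pos huvn
  field_simp

theorem betaIntegral_ne_zero {u v : ℂ} (hu : 0 < u.re) (hv : 0 < v.re) :
    Complex.betaIntegral u v ≠ 0 := by
  have huv : 0 < (u + v).re := by simpa using add_pos hu hv
  rw [Complex.betaIntegral_eq_Gamma_mul_div _ _ hu hv]
  exact div_ne_zero (mul_ne_zero (Complex.Gamma_ne_zero_of_re_pos hu)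
    (Complex.Gamma_ne_zero_of_re_pos hv)) (Complex.Gamma_ne_zero_of_re_pos huv)

theorem eulerIntegral_eq_ordinaryHypergeometric (a : ℂ) {b c z : ℂ} (hb : 0 < b.re)
    (hbc : b.re < c.re) (hz : ‖z‖ < 1) :
    eulerIntegral a b c z = Complex.betaIntegral b (c - b) * ordinaryHypergeometric a b c z := by
  have hcb : 0 < (c - b).re := by simpa using hbc
  rw [← (hasSum_eulerIntegral a hb hbc hz).tsum_eq, ordinaryHypergeometric_eq_tsum, ← tsum_mul_left]
  refine tsum_congr fun n => ?_
  rw [betaIntegral_add_nat_left hb hcb, add_sub_cancel, smul_eq_mul]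
  ring

/-- Differentiation under the integral sign: the `z`-derivative of the last factor is bounded on the
compact product of a small closed ball with `[0, 1]`, and the Beta weight is integrable. -/
theorem differentiableOn_eulerIntegral (a : ℂ) {b c : ℂ} (hb : 0 < b.re) (hbc : b.re < c.re) :
    DifferentiableOn ℂ (eulerIntegral a b c) cutPlane := by
  intro z₀ hz₀
  have hcb : 0 < (c - b).re := by simpa using hbc
  have hw := Complex.betaIntegral_convergent hb hcb
  obtain ⟨ε, hε, hball⟩ := Metric.nhds_basis_closedBall.mem_iff.1 (isOpen_cutPlane.mem_nhds hz₀)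
  have hcomp : IsCompact (Metric.closedBall z₀ ε ×ˢ Set.Icc (0 : ℝ) 1) :=
    (isCompact_closedBall _ _).prod isCompact_Icc
  have hcont : ContinuousOn (fun p : ℂ × ℝ => -a * (1 - p.1 * p.2) ^ (-a - 1) * -(p.2 : ℂ))
      (Metric.closedBall z₀ ε ×ˢ Set.Icc (0 : ℝ) 1) := by
    refine ContinuousOn.mul (ContinuousOn.mul continuousOn_const ?_) (by fun_prop)
    exact ContinuousOn.cpow_const (by fun_prop)
      fun p hp => one_sub_mul_mem_slitPlane (hball hp.1) hp.2
  obtain ⟨M, hM⟩ := hcomp.exists_bound_of_continuousOn hcont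
  have hint : ∀ (s : ℂ) {z : ℂ}, z ∈ cutPlane → IntervalIntegrable (fun t : ℝ =>
      ((t : ℂ) ^ (b - 1) * (1 - (t : ℂ)) ^ (c - b - 1)) * (1 - z * t) ^ s)
      MeasureTheory.volume 0 1 := fun s z hz =>
    hw.mul_continuousOn (by
      rw [Set.uIcc_of_le zero_le_one]; exact continuousOn_one_sub_mul_cpow s hz)
  refine (intervalIntegral.hasDerivAt_integral_of_dominated_loc_of_deriv_le
    (F := fun (z : ℂ) (t : ℝ) =>
      ((t : ℂ) ^ (b - 1) * (1 - (t : ℂ)) ^ (c - b - 1)) * (1 - z * t) ^ (-a))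
    (F' := fun (z : ℂ) (t : ℝ) => ((t : ℂ) ^ (b - 1) * (1 - (t : ℂ)) ^ (c - b - 1)) *
      (-a * (1 - z * t) ^ (-a - 1) * -(t : ℂ)))
    (bound := fun t => ‖(t : ℂ) ^ (b - 1) * (1 - (t : ℂ)) ^ (c - b - 1)‖ * M)
    (Metric.closedBall_mem_nhds z₀ hε) ?_ (hint _ hz₀) ?_ ?_ (hw.norm.mul_const _)
    ?_).2.differentiableAt.differentiableWithinAt
  · filter_upwards [isOpen_cutPlane.mem_nhds hz₀] with z hz
    exact (hint _ hz).def'.aestronglyMeasurable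
  · refine (hw.mul_continuousOn ?_).def'.aestronglyMeasurable
    rw [Set.uIcc_of_le zero_le_one]
    exact (continuousOn_const.mul (continuousOn_one_sub_mul_cpow _ hz₀)).mul (by fun_prop)
  · refine Filter.Eventually.of_forall fun t ht z hz => ?_
    rw [Set.uIoc_of_le zero_le_one] at ht
    rw [norm_mul]
    exact mul_le_mul_of_nonneg_left (hM (z, t) ⟨hz, Set.Ioc_subset_Icc_self ht⟩) (norm_nonneg _)
  · refine Filter.Eventually.of_forall fun t ht z hz => ?_
    rw [Set.uIoc_of_le zero_le_one] at ht
    refine HasDerivAt.const_mul _ ?_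
    have h1 : HasDerivAt (fun z : ℂ => 1 - z * t) (-(t : ℂ)) z := by
      simpa using ((hasDerivAt_id z).mul_const (t : ℂ)).const_sub 1
    exact h1.cpow_const (one_sub_mul_mem_slitPlane (hball hz) (Set.Ioc_subset_Icc_self ht))

/-- Euler's integral continues Gauss's series to the cut plane. -/
theorem isGaussContinuation_eulerIntegral (a : ℂ) {b c : ℂ} (hb : 0 < b.re) (hbc : b.re < c.re) :
    IsGaussContinuation a b c
      (fun z => (Complex.betaIntegral b (c - b))⁻¹ * eulerIntegral a b c z) := by
  have hcb : 0 < (c - b).re := by simpa using hbc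
  refine ⟨(differentiableOn_eulerIntegral a hb hbc).const_mul _, fun z hz => ?_⟩
  dsimp only
  rw [eulerIntegral_eq_ordinaryHypergeometric a hb hbc (by simpa using hz),
    inv_mul_cancel_left₀ (betaIntegral_ne_zero hb hcb)]

theorem betaIntegral_mul_gaussF (a : ℂ) {b c z : ℂ} (hb : 0 < b.re) (hbc : b.re < c.re)
    (hz : z ∈ cutPlane) :
    Complex.betaIntegral b (c - b) * gaussF a b c z = eulerIntegral a b c z := by
  have hcb : 0 < (c - b).re := by simpa using hbc
  rw [gaussF_eqOn (isGaussContinuation_eulerIntegral a hb hbc) hz,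
    mul_inv_cancel_left₀ (betaIntegral_ne_zero hb hcb)]
-- Dirichlet's integral for the digamma function.
-- Mean value inequality: the derivative of `s ^ (-a)` is largest in norm at the left endpoint. All
-- linear dependence on `‖a‖` in the error comes from here.
theorem norm_ofReal_cpow_neg_sub_le {a : ℂ} (ha : 0 ≤ a.re) {u v : ℝ} (hu : 0 < u) (huv : u ≤ v) :
    ‖(v : ℂ) ^ (-a) - (u : ℂ) ^ (-a)‖ ≤ ‖a‖ * u ^ (-a.re - 1) * (v - u) := by
  refine norm_image_sub_le_of_norm_deriv_le_segment' (f := fun s : ℝ => (s : ℂ) ^ (-a))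
    (f' := fun s : ℝ => -a * (s : ℂ) ^ (-a - 1)) (a := u) (b := v) (fun s hs => ?_)
    (fun s hs => ?_) v (Set.right_mem_Icc.2 huv)
  · have hs0 : 0 < s := hu.trans_le hs.1
    have h := ((hasDerivAt_id (s : ℂ)).cpow_const (c := -a)
      (Complex.ofReal_mem_slitPlane.2 hs0)).comp_ofReal
    simpa using h.hasDerivWithinAt
  · have hs0 : 0 < s := hu.trans_le hs.1
    rw [norm_mul, norm_neg, Complex.norm_cpow_eq_rpow_re_of_pos hs0]
    refine mul_le_mul_of_nonneg_left ?_ (norm_nonneg a)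
    simpa using Real.rpow_le_rpow_of_nonpos hu hs.1 (by linarith)

theorem injOn_one_add_inv : Set.InjOn (fun p : ℝ => (1 + p)⁻¹) (Set.Ioi 0) := fun p _ q _ h => by
  simpa using h

theorem image_one_add_inv : (fun p : ℝ => (1 + p)⁻¹) '' Set.Ioi 0 = Set.Ioo 0 1 := by
  ext t
  constructor
  · rintro ⟨p, hp, rfl⟩
    have hp : 0 < p := hp
    exact ⟨by positivity, inv_lt_one_of_one_lt₀ (by linarith)⟩
  · rintro ⟨h0, h1⟩
    exact ⟨t⁻¹ - 1, by simpa using (one_lt_inv₀ h0).2 h1, by simp⟩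

theorem hasDerivWithinAt_one_add_inv {p : ℝ} (hp : p ∈ Set.Ioi (0 : ℝ)) :
    HasDerivWithinAt (fun p : ℝ => (1 + p)⁻¹) (-1 / (1 + p) ^ 2) (Set.Ioi 0) p := by
  have hp : 0 < p := hp
  exact (((hasDerivAt_id p).const_add 1).inv (by positivity)).hasDerivWithinAt

theorem betaIntegral_integrand_comp {u v : ℂ} {p : ℝ} (hp : 0 < p) :
    |(-1 : ℝ) / (1 + p) ^ 2| • ((((1 + p)⁻¹ : ℝ) : ℂ) ^ (u - 1) *
      (1 - (((1 + p)⁻¹ : ℝ) : ℂ)) ^ (v - 1)) =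
      (p : ℂ) ^ (v - 1) * ((1 + p : ℝ) : ℂ) ^ (-(u + v)) := by
  have h1 : 0 < 1 + p := by positivity
  have hc : ((1 + p : ℝ) : ℂ) ≠ 0 := by exact_mod_cast h1.ne'
  have hq : (1 - (((1 + p)⁻¹ : ℝ) : ℂ)) = ((p * (1 + p)⁻¹ : ℝ) : ℂ) := by
    have : 1 - (1 + p)⁻¹ = p * (1 + p)⁻¹ := by field_simp; ring
    rw [← this]; push_cast; rfl
  have habs : |(-1 : ℝ) / (1 + p) ^ 2| = ((1 + p) ^ 2)⁻¹ := by
    rw [abs_div, abs_neg, abs_one, abs_of_pos (by positivity), one_div]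
  have harg : ((1 + p : ℝ) : ℂ).arg ≠ Real.pi := by
    rw [Complex.arg_ofReal_of_nonneg h1.le]; exact Real.pi_pos.ne
  rw [hq, habs, Complex.ofReal_mul, Complex.mul_cpow_ofReal_nonneg hp.le (by positivity),
    Complex.ofReal_inv, Complex.inv_cpow _ _ harg, Complex.inv_cpow _ _ harg,
    ← Complex.cpow_neg, ← Complex.cpow_neg, Complex.real_smul,
    show -(u + v) = -(u - 1) + -(v - 1) + -2 by ring, Complex.cpow_add _ _ hc,
    Complex.cpow_add _ _ hc, Complex.cpow_neg _ 2, Complex.cpow_ofNat]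
  push_cast
  ring

open MeasureTheory in
/-- The Beta integral as an integral over the half-line. -/
theorem betaIntegral_eq_integral_Ioi {u v : ℂ} (hu : 0 < u.re) (hv : 0 < v.re) :
    IntegrableOn (fun p : ℝ => (p : ℂ) ^ (v - 1) * ((1 + p : ℝ) : ℂ) ^ (-(u + v))) (Set.Ioi 0) ∧
    Complex.betaIntegral u v =
      ∫ p in Set.Ioi (0 : ℝ), (p : ℂ) ^ (v - 1) * ((1 + p : ℝ) : ℂ) ^ (-(u + v)) := by
  have hw := Complex.betaIntegral_convergent hu hv
  rw [intervalIntegrable_iff_integrableOn_Ioo_of_le zero_le_one, ← image_one_add_inv,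
    integrableOn_image_iff_integrableOn_abs_deriv_smul measurableSet_Ioi
      (fun _ hp => hasDerivWithinAt_one_add_inv hp) injOn_one_add_inv] at hw
  constructor
  · exact hw.congr_fun (fun p hp => betaIntegral_integrand_comp hp) measurableSet_Ioi
  · rw [Complex.betaIntegral, intervalIntegral.integral_of_le zero_le_one,
      integral_Ioc_eq_integral_Ioo, ← image_one_add_inv,
      integral_image_eq_integral_abs_deriv_smul measurableSet_Ioi
        (fun _ hp => hasDerivWithinAt_one_add_inv hp) injOn_one_add_inv]
    exact setIntegral_congr_fun measurableSet_Ioi fun p hp => betaIntegral_integrand_comp hp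

/-- The integrand of Dirichlet's integral for `ψ(a) - ψ(1)`. -/
noncomputable def dirichletKernel (a : ℂ) (p : ℝ) : ℂ :=
  (((1 + p : ℝ) : ℂ) ^ (-1 : ℂ) - ((1 + p : ℝ) : ℂ) ^ (-a)) / p

theorem norm_dirichletKernel_le {a : ℂ} (ha : 0 ≤ a.re) {p : ℝ} (hp : 0 < p) :
    ‖dirichletKernel a p‖ ≤ 1 + ‖a‖ := by
  have h1 := norm_ofReal_cpow_neg_sub_le ha one_pos (v := 1 + p) (by linarith)
  have h2 := norm_ofReal_cpow_neg_sub_le (a := 1) (by simp) one_pos (v := 1 + p) (by linarith)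
  simp only [Complex.ofReal_one, Complex.one_cpow, Real.one_rpow, norm_one, add_sub_cancel_left]
    at h1 h2
  rw [dirichletKernel, norm_div, Complex.norm_real, Real.norm_of_nonneg hp.le, div_le_iff₀ hp,
    ← sub_sub_sub_cancel_right _ _ (1 : ℂ)]
  refine (norm_sub_le _ _).trans ?_
  linarith

theorem norm_dirichletKernel_le_rpow {a : ℂ} (ha : 0 ≤ a.re) {p : ℝ} (hp : 0 < p) :
    ‖dirichletKernel a p‖ ≤ p ^ (-2 : ℝ) + p ^ (-a.re - 1) := by
  have h1 : 0 < 1 + p := by positivity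
  have key : ∀ s : ℂ, 0 ≤ s.re → ‖((1 + p : ℝ) : ℂ) ^ (-s)‖ ≤ p ^ (-s.re) := fun s hs => by
    rw [Complex.norm_cpow_eq_rpow_re_of_pos h1, Complex.neg_re]
    exact Real.rpow_le_rpow_of_nonpos hp (by linarith) (by linarith)
  rw [dirichletKernel, norm_div, Complex.norm_real, Real.norm_of_nonneg hp.le, div_le_iff₀ hp,
    add_mul, show (-2 : ℝ) = -1 - 1 by norm_num, Real.rpow_sub_one hp.ne', Real.rpow_sub_one hp.ne',
    div_mul_cancel₀ _ hp.ne', div_mul_cancel₀ _ hp.ne']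
  refine (norm_sub_le _ _).trans (add_le_add ?_ (key a ha))
  simpa using key 1 (by simp)

theorem continuousOn_one_add_cpow (s : ℂ) :
    ContinuousOn (fun p : ℝ => ((1 + p : ℝ) : ℂ) ^ s) (Set.Ioi 0) := by
  refine ContinuousOn.cpow_const (by fun_prop) fun p hp => Complex.ofReal_mem_slitPlane.2 ?_
  have hp : 0 < p := hp
  positivity

theorem continuousOn_dirichletKernel (a : ℂ) :
    ContinuousOn (dirichletKernel a) (Set.Ioi 0) :=
  ((continuousOn_one_add_cpow _).sub (continuousOn_one_add_cpow _)).div (by fun_prop)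
    fun p hp => by exact_mod_cast (ne_of_gt hp)

open MeasureTheory in
theorem integrableOn_dirichletKernel {a : ℂ} (ha : 0 < a.re) :
    IntegrableOn (dirichletKernel a) (Set.Ioi 0) := by
  have hm := (continuousOn_dirichletKernel a).aestronglyMeasurable measurableSet_Ioi (μ := volume)
  rw [← Set.Ioc_union_Ioi_eq_Ioi zero_le_one]
  refine IntegrableOn.union ?_ ?_
  · refine IntegrableOn.of_bound (by simp)
      (hm.mono_measure (Measure.restrict_mono Set.Ioc_subset_Ioi_self le_rfl)) (1 + ‖a‖) ?_
    filter_upwards [ae_restrict_mem measurableSet_Ioc] with p hp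
    exact norm_dirichletKernel_le ha.le hp.1
  · refine Integrable.mono' ((integrableOn_Ioi_rpow_of_lt (by norm_num : (-2 : ℝ) < -1) one_pos).add
      (integrableOn_Ioi_rpow_of_lt (by linarith : -a.re - 1 < -1) one_pos))
      (hm.mono_measure (Measure.restrict_mono (Set.Ioi_subset_Ioi zero_le_one) le_rfl)) ?_
    filter_upwards [ae_restrict_mem measurableSet_Ioi] with p hp
    exact norm_dirichletKernel_le_rpow ha.le (one_pos.trans hp)

open MeasureTheory in
theorem norm_integral_dirichletKernel_le {a : ℂ} (ha : 0 < a.re) :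
    ‖∫ p in Set.Ioi (0 : ℝ), dirichletKernel a p‖ ≤ 2 + ‖a‖ + 1 / a.re := by
  have hi := integrableOn_dirichletKernel ha
  rw [← Set.Ioc_union_Ioi_eq_Ioi zero_le_one, setIntegral_union Set.Ioc_disjoint_Ioi_same
    measurableSet_Ioi (hi.mono_set Set.Ioc_subset_Ioi_self)
    (hi.mono_set (Set.Ioi_subset_Ioi zero_le_one))]
  have h1 : ‖∫ p in Set.Ioc (0 : ℝ) 1, dirichletKernel a p‖ ≤ 1 + ‖a‖ := by
    simpa using norm_setIntegral_le_of_norm_le_const (μ := volume) (s := Set.Ioc (0 : ℝ) 1)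
      (by simp) fun p hp => norm_dirichletKernel_le ha.le hp.1
  have i1 := integrableOn_Ioi_rpow_of_lt (by norm_num : (-2 : ℝ) < -1) one_pos
  have i2 := integrableOn_Ioi_rpow_of_lt (by linarith : -a.re - 1 < -1) one_pos
  have h2 : ‖∫ p in Set.Ioi (1 : ℝ), dirichletKernel a p‖ ≤ 1 + 1 / a.re := by
    refine (norm_integral_le_of_norm_le (i1.add i2) ?_).trans_eq ?_
    · filter_upwards [ae_restrict_mem measurableSet_Ioi] with p hp
      exact norm_dirichletKernel_le_rpow ha.le (one_pos.trans hp)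
    · simp only [Pi.add_apply]
      rw [integral_add i1 i2, integral_Ioi_rpow_of_lt (by norm_num) one_pos,
        integral_Ioi_rpow_of_lt (by linarith) one_pos, Real.one_rpow, Real.one_rpow,
        sub_add_cancel, neg_div_neg_eq]
      norm_num
  exact (norm_add_le _ _).trans (by linarith)

open MeasureTheory Filter Topology in
/-- Dirichlet's integral for the digamma function. -/
theorem integral_dirichletKernel {a : ℂ} (ha : 0 < a.re) :
    ∫ p in Set.Ioi (0 : ℝ), dirichletKernel a p = Complex.digamma a - Complex.digamma 1 := by
  set φ : ℂ → ℂ := fun e => Complex.Gamma a * Complex.Gamma (1 + e) / Complex.Gamma (a + e) with hφ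
  have hGa : Complex.Gamma a ≠ 0 := Complex.Gamma_ne_zero_of_re_pos ha
  have ne : ∀ {s : ℂ}, 0 < s.re → ∀ m : ℕ, s ≠ -m := by
    intro s hs m h
    rw [h] at hs
    simp at hs
    linarith [(Nat.cast_nonneg m : (0 : ℝ) ≤ m)]
  have hd : ∀ s : ℂ, 0 < s.re → HasDerivAt (fun e => Complex.Gamma (s + e))
      (deriv Complex.Gamma s) 0 := fun s hs => by
    have h := (Complex.differentiableAt_Gamma s (ne hs)).hasDerivAt
    rw [← add_zero s] at h
    simpa using h.comp_const_add s 0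
  have hφ' : HasDerivAt φ (Complex.digamma 1 - Complex.digamma a) 0 := by
    have h := ((hd 1 (by simp)).const_mul (Complex.Gamma a)).div (hd a ha) (by simpa using hGa)
    refine h.congr_deriv ?_
    simp only [Complex.digamma_def, logDeriv_apply, add_zero, Complex.Gamma_one]
    field_simp
  -- In Gamma form, with `Γ(1 + e) = e Γ(e)`, this difference is the slope `(φ e - φ 0) / e`, where
  -- `φ 0 = 1`.
  have hlim1 : Tendsto (fun e : ℝ => Complex.betaIntegral a e - Complex.betaIntegral 1 e)
      (𝓝[>] 0) (𝓝 (Complex.digamma 1 - Complex.digamma a)) := by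
    have h0 : HasDerivAt (fun e : ℝ => φ e) (Complex.digamma 1 - Complex.digamma a) 0 := by
      have := HasDerivAt.comp_ofReal (z := 0) (e := φ) (by simpa using hφ')
      exact this
    have h := (hasDerivAt_iff_tendsto_slope.1 h0).mono_left
      (nhdsWithin_mono _ (fun x (hx : 0 < x) => hx.ne' : Set.Ioi (0 : ℝ) ⊆ {0}ᶜ))
    refine h.congr' ?_
    filter_upwards [self_mem_nhdsWithin] with e he
    have he : 0 < e := he
    have hec : (e : ℂ) ≠ 0 := by exact_mod_cast he.ne'
    have hae : 0 < (a + e).re := by simpa using add_pos ha he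
    have h1e : 0 < (1 + (e : ℂ)).re := by simpa using add_pos one_pos he
    rw [Complex.betaIntegral_eq_Gamma_mul_div _ _ ha (by simpa using he),
      Complex.betaIntegral_eq_Gamma_mul_div _ _ (by simp) (by simpa using he), slope_def_module,
      hφ]
    have hG : Complex.Gamma (1 + e) = e * Complex.Gamma e := by
      rw [add_comm, Complex.Gamma_add_one _ hec]
    have hGe := Complex.Gamma_ne_zero_of_re_pos (s := e) (by simpa using he)
    have hGae := Complex.Gamma_ne_zero_of_re_pos hae
    simp only [hG, sub_zero, Complex.ofReal_zero, add_zero, Complex.Gamma_one, mul_one,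
      Complex.real_smul, Complex.ofReal_inv]
    field_simp
  -- On the half-line the same difference is minus the integral of `(p / (1 + p)) ^ e` times the
  -- Dirichlet kernel. That factor has norm at most `1` and tends to `1`, so dominated convergence
  -- applies.
  have hlim2 : Tendsto (fun e : ℝ => Complex.betaIntegral a e - Complex.betaIntegral 1 e)
      (𝓝[>] 0) (𝓝 (∫ p in Set.Ioi (0 : ℝ), -dirichletKernel a p)) := by
    have hd : Tendsto (fun e : ℝ => ∫ p in Set.Ioi (0 : ℝ),
        -((p : ℂ) ^ (e : ℂ) * ((1 + p : ℝ) : ℂ) ^ (-e : ℂ) * dirichletKernel a p))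
        (𝓝[>] 0) (𝓝 (∫ p in Set.Ioi (0 : ℝ), -dirichletKernel a p)) := by
      refine tendsto_integral_filter_of_dominated_convergence (fun p => ‖dirichletKernel a p‖)
        ?_ ?_ (integrableOn_dirichletKernel ha).norm ?_
      · refine Eventually.of_forall fun e => ContinuousOn.aestronglyMeasurable ?_ measurableSet_Ioi
        refine ((ContinuousOn.cpow_const (by fun_prop) fun p hp =>
          Complex.ofReal_mem_slitPlane.2 hp).mul (continuousOn_one_add_cpow _)).mul
          (continuousOn_dirichletKernel a) |>.neg
      · filter_upwards [self_mem_nhdsWithin] with e he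
        have he : 0 < e := he
        filter_upwards [ae_restrict_mem measurableSet_Ioi] with p hp
        have hp : 0 < p := hp
        rw [norm_neg, norm_mul, norm_mul, Complex.norm_cpow_eq_rpow_re_of_pos hp,
          Complex.norm_cpow_eq_rpow_re_of_pos (by positivity)]
        refine mul_le_of_le_one_left (norm_nonneg _) ?_
        simp only [Complex.ofReal_re, Complex.neg_re]
        rw [Real.rpow_neg (by positivity), ← div_eq_mul_inv, div_le_one (by positivity)]
        exact Real.rpow_le_rpow hp.le (by linarith) he.le
      · filter_upwards [ae_restrict_mem measurableSet_Ioi] with p hp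
        have hp : 0 < p := hp
        have hpc : (p : ℂ) ≠ 0 := by exact_mod_cast hp.ne'
        have hpc1 : ((1 + p : ℝ) : ℂ) ≠ 0 := by
          have : 0 < 1 + p := by positivity
          exact_mod_cast this.ne'
        have hcont : Continuous fun e : ℝ =>
            -((p : ℂ) ^ (e : ℂ) * ((1 + p : ℝ) : ℂ) ^ (-e : ℂ) * dirichletKernel a p) :=
          (((Complex.continuous_ofReal.const_cpow (Or.inl hpc)).mul
            (Complex.continuous_ofReal.neg.const_cpow (Or.inl hpc1))).mul continuous_const).neg
        have := (hcont.tendsto 0).mono_left (nhdsWithin_le_nhds (s := Set.Ioi 0))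
        simpa using this
    refine hd.congr' ?_
    filter_upwards [self_mem_nhdsWithin] with e he
    have he : 0 < (e : ℂ).re := by simpa using he
    obtain ⟨i1, e1⟩ := betaIntegral_eq_integral_Ioi ha he
    obtain ⟨i2, e2⟩ := betaIntegral_eq_integral_Ioi (u := 1) (by simp) he
    rw [e1, e2, ← integral_sub i1 i2]
    refine setIntegral_congr_fun measurableSet_Ioi fun p hp => ?_
    have hp : 0 < p := hp
    have hpc : (p : ℂ) ≠ 0 := by exact_mod_cast hp.ne'
    have hpc1 : ((1 + p : ℝ) : ℂ) ≠ 0 := by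
      have : 0 < 1 + p := by positivity
      exact_mod_cast this.ne'
    simp only [dirichletKernel]
    rw [neg_add, neg_add, Complex.cpow_add _ _ hpc1, Complex.cpow_add _ _ hpc1,
      Complex.cpow_sub _ _ hpc, Complex.cpow_one]
    ring
  have := tendsto_nhds_unique hlim2 hlim1
  rw [integral_neg] at this
  linear_combination -this
-- Laplace's integral and its symmetry.
/-- The base of the integrand in Laplace's integral for the Legendre function. -/
noncomputable def laplaceBase (x p : ℝ) : ℝ := 1 + 2 * x + p + x * (1 + x) / p

/-- The integrand `(1 + 2 x + p + x (1 + x) / p) ^ (-a) / p` of Laplace's integral. -/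
noncomputable def laplaceKernel (a : ℂ) (x p : ℝ) : ℂ := (laplaceBase x p : ℂ) ^ (-a) / p

theorem one_add_le_laplaceBase {x p : ℝ} (hx : 0 < x) (hp : 0 < p) : 1 + p ≤ laplaceBase x p := by
  have : 0 < x * (1 + x) / p := by positivity
  rw [laplaceBase]; linarith

theorem laplaceBase_pos {x p : ℝ} (hx : 0 < x) (hp : 0 < p) : 0 < laplaceBase x p := by
  linarith [one_add_le_laplaceBase hx hp]

theorem injOn_div_add {k : ℝ} (hk : 0 < k) : Set.InjOn (fun p : ℝ => p / (p + k)) (Set.Ioi 0) := by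
  intro p hp q hq h
  have hp : 0 < p := hp
  have hq : 0 < q := hq
  dsimp only at h
  rw [div_eq_div_iff (by positivity) (by positivity)] at h
  nlinarith

theorem image_div_add {k : ℝ} (hk : 0 < k) :
    (fun p : ℝ => p / (p + k)) '' Set.Ioi 0 = Set.Ioo 0 1 := by
  ext t
  constructor
  · rintro ⟨p, hp, rfl⟩
    have hp : 0 < p := hp
    exact ⟨by positivity, (div_lt_one (by positivity)).2 (by linarith)⟩
  · rintro ⟨h0, h1⟩
    have h2 : 0 < 1 - t := by linarith
    refine ⟨k * t / (1 - t), Set.mem_Ioi.2 (by positivity), ?_⟩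
    field_simp
    ring

theorem hasDerivWithinAt_div_add {k p : ℝ} (hk : 0 < k) (hp : p ∈ Set.Ioi (0 : ℝ)) :
    HasDerivWithinAt (fun p : ℝ => p / (p + k)) (k / (p + k) ^ 2) (Set.Ioi 0) p := by
  have hp : 0 < p := hp
  refine (((hasDerivAt_id p).div ((hasDerivAt_id p).add_const k)
    (by simp; positivity)).congr_deriv ?_).hasDerivWithinAt
  simp

theorem ofReal_cpow_mul_cpow_mul_cpow_neg (a : ℂ) {t s w x A : ℝ} (ht : 0 < t) (hs : 0 < s)
    (hw : 0 < w) (hx : 0 < x) (hA : 0 < A) (h : t * s * w⁻¹ = x * A⁻¹) :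
    (t : ℂ) ^ a * (s : ℂ) ^ a * (w : ℂ) ^ (-a) = (x : ℂ) ^ a * (A : ℂ) ^ (-a) := by
  have hn : ∀ {v : ℝ}, 0 < v → (v : ℂ) ^ (-a) = ((v⁻¹ : ℝ) : ℂ) ^ a := fun {v} hv => by
    rw [Complex.ofReal_inv, Complex.inv_cpow, Complex.cpow_neg]
    rw [Complex.arg_ofReal_of_nonneg hv.le]; exact Real.pi_pos.ne
  rw [hn hw, hn hA, ← Complex.mul_cpow_ofReal_nonneg ht.le hs.le, ← Complex.ofReal_mul,
    ← Complex.mul_cpow_ofReal_nonneg (by positivity) (by positivity), ← Complex.ofReal_mul, h,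
    Complex.ofReal_mul, Complex.mul_cpow_ofReal_nonneg hx.le (by positivity)]

-- With `t = p / (p + 1 + x)` one has `t (1 - t) / (1 + t / x) = x / A(p)` and `dt / (t (1 - t)) =
-- dp / p`.
open MeasureTheory in
theorem eulerIntegral_eq_integral_laplaceKernel (a : ℂ) {x : ℝ} (hx : 0 < x) :
    eulerIntegral a a (2 * a) (-((x⁻¹ : ℝ) : ℂ)) =
      (x : ℂ) ^ a * ∫ p in Set.Ioi (0 : ℝ), laplaceKernel a x p := by
  have hk : 0 < 1 + x := by positivity
  rw [eulerIntegral, intervalIntegral.integral_of_le zero_le_one, integral_Ioc_eq_integral_Ioo,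
    ← image_div_add hk, integral_image_eq_integral_abs_deriv_smul measurableSet_Ioi
      (fun _ hp => hasDerivWithinAt_div_add hk hp) (injOn_div_add hk), ← integral_const_mul]
  refine setIntegral_congr_fun measurableSet_Ioi fun p hp => ?_
  have hp : 0 < p := hp
  have hA := laplaceBase_pos hx hp
  have ht : 0 < p / (p + (1 + x)) := by positivity
  have hs : 0 < (1 + x) / (p + (1 + x)) := by positivity
  have hw : 0 < 1 + x⁻¹ * (p / (p + (1 + x))) := by positivity
  have h1t : (1 : ℂ) - ((p / (p + (1 + x)) : ℝ) : ℂ) = (((1 + x) / (p + (1 + x)) : ℝ) : ℂ) := by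
    rw [← Complex.ofReal_one, ← Complex.ofReal_sub]
    congr 1
    field_simp
    ring
  have hwc : (1 : ℂ) - -((x⁻¹ : ℝ) : ℂ) * ((p / (p + (1 + x)) : ℝ) : ℂ) =
      ((1 + x⁻¹ * (p / (p + (1 + x))) : ℝ) : ℂ) := by
    push_cast; ring
  have key := ofReal_cpow_mul_cpow_mul_cpow_neg a ht hs hw hx hA (by
    rw [laplaceBase]
    field_simp
    ring)
  rw [h1t, hwc, abs_of_pos (by positivity), show 2 * a - a - 1 = a - 1 by ring,
    Complex.cpow_sub _ _ (by exact_mod_cast ht.ne'), Complex.cpow_sub _ _ (by exact_mod_cast hs.ne'),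
    Complex.cpow_one, Complex.cpow_one, laplaceKernel, Complex.real_smul,
    ← mul_div_assoc ((x : ℂ) ^ a), ← key]
  have e : ((1 + x) / (p + (1 + x)) ^ 2 : ℝ) =
      p⁻¹ * ((p / (p + (1 + x))) * ((1 + x) / (p + (1 + x)))) := by
    field_simp
  rw [e, Complex.ofReal_mul, Complex.ofReal_mul, Complex.ofReal_inv]
  have htc : ((p / (p + (1 + x)) : ℝ) : ℂ) ≠ 0 := by exact_mod_cast ht.ne'
  have hsc : (((1 + x) / (p + (1 + x)) : ℝ) : ℂ) ≠ 0 := by exact_mod_cast hs.ne'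
  have hpc : (p : ℂ) ≠ 0 := by exact_mod_cast hp.ne'
  generalize ((p / (p + (1 + x)) : ℝ) : ℂ) = t at *
  generalize (((1 + x) / (p + (1 + x)) : ℝ) : ℂ) = s at *
  field_simp

theorem continuousOn_laplaceKernel (a : ℂ) {x : ℝ} (hx : 0 < x) :
    ContinuousOn (laplaceKernel a x) (Set.Ioi 0) := by
  have hne : ∀ p ∈ Set.Ioi (0 : ℝ), p ≠ 0 := fun p hp => ne_of_gt hp
  have hb : ContinuousOn (fun p => (laplaceBase x p : ℂ)) (Set.Ioi 0) := by
    unfold laplaceBase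
    refine Complex.continuous_ofReal.comp_continuousOn (ContinuousOn.add (by fun_prop) ?_)
    exact continuousOn_const.div continuousOn_id hne
  exact (hb.cpow_const fun p hp => Complex.ofReal_mem_slitPlane.2 (laplaceBase_pos hx hp)).div
    (by fun_prop) fun p hp => by exact_mod_cast hne p hp

theorem norm_laplaceKernel_le {a : ℂ} (ha : 0 ≤ a.re) {x p : ℝ} (hx : 0 < x) (hp : 0 < p) :
    ‖laplaceKernel a x p‖ ≤ p ^ (-a.re - 1) := by
  rw [laplaceKernel, norm_div, Complex.norm_real, Real.norm_of_nonneg hp.le,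
    Real.rpow_sub_one hp.ne', Complex.norm_cpow_eq_rpow_re_of_pos (laplaceBase_pos hx hp)]
  gcongr
  exact Real.rpow_le_rpow_of_nonpos hp (by linarith [one_add_le_laplaceBase hx hp]) (by simpa)

open MeasureTheory in
theorem integrableOn_laplaceKernel_Ioi {a : ℂ} (ha : 0 < a.re) {x b : ℝ} (hx : 0 < x)
    (hb : 0 < b) : IntegrableOn (laplaceKernel a x) (Set.Ioi b) := by
  refine Integrable.mono' (integrableOn_Ioi_rpow_of_lt (by linarith : -a.re - 1 < -1) hb)
    (((continuousOn_laplaceKernel a hx).mono (Set.Ioi_subset_Ioi hb.le)).aestronglyMeasurable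
      measurableSet_Ioi) ?_
  filter_upwards [ae_restrict_mem measurableSet_Ioi] with p hp
  exact norm_laplaceKernel_le ha.le hx (hb.trans hp)

open MeasureTheory in
theorem norm_integral_laplaceKernel_le {a : ℂ} (ha : 0 < a.re) {x b : ℝ} (hx : 0 < x)
    (hb : 0 < b) : ‖∫ p in Set.Ioi b, laplaceKernel a x p‖ ≤ b ^ (-a.re) / a.re := by
  refine (norm_integral_le_of_norm_le
    (integrableOn_Ioi_rpow_of_lt (by linarith : -a.re - 1 < -1) hb) ?_).trans_eq ?_
  · filter_upwards [ae_restrict_mem measurableSet_Ioi] with p hp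
    exact norm_laplaceKernel_le ha.le hx (hb.trans hp)
  · rw [integral_Ioi_rpow_of_lt (by linarith) hb, sub_add_cancel, neg_div_neg_eq]

theorem image_sq_div {b : ℝ} (hb : 0 < b) :
    (fun p : ℝ => b ^ 2 / p) '' Set.Ioi b = Set.Ioo 0 b := by
  ext t
  constructor
  · rintro ⟨p, hp, rfl⟩
    have hp : b < p := hp
    have hp0 : 0 < p := hb.trans hp
    exact ⟨by positivity, (div_lt_iff₀ hp0).2 (by nlinarith)⟩
  · rintro ⟨h0, h1⟩
    exact ⟨b ^ 2 / t, (lt_div_iff₀ h0).2 (by nlinarith), by field_simp⟩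

theorem injOn_sq_div {b : ℝ} (hb : 0 < b) : Set.InjOn (fun p : ℝ => b ^ 2 / p) (Set.Ioi b) := by
  intro p hp q hq h
  have hp : 0 < p := hb.trans hp
  have hq : 0 < q := hb.trans hq
  dsimp only at h
  rw [div_eq_div_iff hp.ne' hq.ne'] at h
  exact (mul_left_cancel₀ (by positivity) h).symm

theorem hasDerivWithinAt_sq_div {b p : ℝ} (hb : 0 < b) (hp : p ∈ Set.Ioi b) :
    HasDerivWithinAt (fun p : ℝ => b ^ 2 / p) (-b ^ 2 / p ^ 2) (Set.Ioi b) p := by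
  have hp : 0 < p := hb.trans hp
  refine (((hasDerivAt_const p (b ^ 2)).div (hasDerivAt_id p) hp.ne').congr_deriv
    ?_).hasDerivWithinAt
  simp

open MeasureTheory in
/-- Laplace's integral is symmetric under `p ↦ x (1 + x) / p`. -/
theorem integral_laplaceKernel_eq_two_mul {a : ℂ} (ha : 0 < a.re) {x : ℝ} (hx : 0 < x) :
    ∫ p in Set.Ioi (0 : ℝ), laplaceKernel a x p =
      2 * ∫ p in Set.Ioi √(x * (1 + x)), laplaceKernel a x p := by
  set b := √(x * (1 + x)) with hbdef
  have hb : 0 < b := Real.sqrt_pos.2 (by positivity)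
  have hb2 : b ^ 2 = x * (1 + x) := Real.sq_sqrt (by positivity)
  have hpt : ∀ p ∈ Set.Ioi b,
      |-b ^ 2 / p ^ 2| • laplaceKernel a x (b ^ 2 / p) = laplaceKernel a x p := fun p hp => by
    have hp : 0 < p := hb.trans hp
    have hA : laplaceBase x (b ^ 2 / p) = laplaceBase x p := by
      rw [laplaceBase, laplaceBase, ← hb2]
      field_simp
      ring
    rw [laplaceKernel, laplaceKernel, hA, neg_div, abs_neg, abs_of_pos (by positivity),
      Complex.real_smul]
    have hpc : (p : ℂ) ≠ 0 := by exact_mod_cast hp.ne'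
    have hbc : (b : ℂ) ≠ 0 := by exact_mod_cast hb.ne'
    push_cast
    field_simp
  have hI := integrableOn_laplaceKernel_Ioi ha hx hb
  -- Integrability near `0` is carried over from the tail by the involution.
  have hI' : IntegrableOn (laplaceKernel a x) (Set.Ioo 0 b) := by
    rw [← image_sq_div hb, integrableOn_image_iff_integrableOn_abs_deriv_smul measurableSet_Ioi
      (fun _ hp => hasDerivWithinAt_sq_div hb hp) (injOn_sq_div hb)]
    exact hI.congr_fun (fun p hp => (hpt p hp).symm) measurableSet_Ioi
  have hE : ∫ p in Set.Ioo 0 b, laplaceKernel a x p = ∫ p in Set.Ioi b, laplaceKernel a x p := by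
    rw [← image_sq_div hb, integral_image_eq_integral_abs_deriv_smul measurableSet_Ioi
      (fun _ hp => hasDerivWithinAt_sq_div hb hp) (injOn_sq_div hb)]
    exact setIntegral_congr_fun measurableSet_Ioi hpt
  rw [← Set.Ioc_union_Ioi_eq_Ioi hb.le, setIntegral_union Set.Ioc_disjoint_Ioi_same
    measurableSet_Ioi (integrableOn_Ioc_iff_integrableOn_Ioo (by simp) |>.2 hI') hI,
    integral_Ioc_eq_integral_Ioo, hE, two_mul]

/-! ### Comparison of Laplace's integral with the logarithmic main term. -/

open MeasureTheory Filter Topology in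
theorem integral_Ioi_one_add_inv_div {b : ℝ} (hb : 0 < b) :
    IntegrableOn (fun p : ℝ => (1 + p)⁻¹ / p) (Set.Ioi b) ∧
      ∫ p in Set.Ioi b, (1 + p)⁻¹ / p = Real.log (1 + b) - Real.log b := by
  have hd : ∀ p ∈ Set.Ici b, HasDerivAt (fun p : ℝ => Real.log p - Real.log (1 + p))
      ((1 + p)⁻¹ / p) p := fun p hp => by
    have hp : 0 < p := hb.trans_le hp
    have h1 : 0 < 1 + p := by positivity
    refine ((Real.hasDerivAt_log hp.ne').sub
      (((hasDerivAt_id p).const_add 1).log h1.ne')).congr_deriv ?_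
    simp only [id]
    field_simp
    ring
  have hlim : Tendsto (fun p : ℝ => Real.log p - Real.log (1 + p)) atTop (𝓝 0) := by
    have h : Tendsto (fun p : ℝ => -Real.log (1 + p⁻¹)) atTop (𝓝 0) := by
      have := ((tendsto_inv_atTop_zero (𝕜 := ℝ)).const_add 1)
      simpa using (this.log (by norm_num)).neg
    refine h.congr' ?_
    filter_upwards [eventually_gt_atTop 0] with p hp
    rw [← Real.log_div hp.ne' (by positivity), ← Real.log_inv]
    congr 1
    field_simp
    ring
  have hpos : ∀ p ∈ Set.Ioi b, 0 ≤ (1 + p)⁻¹ / p := fun p hp => by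
    have hp : 0 < p := hb.trans hp
    positivity
  refine ⟨integrableOn_Ioi_deriv_of_nonneg' hd hpos hlim, ?_⟩
  rw [integral_Ioi_of_hasDerivAt_of_nonneg' hd hpos hlim]
  ring

open MeasureTheory in
/-- The part of Laplace's integral that the logarithmic main term does not account for. -/
theorem laplace_integral_add_log {a : ℂ} (ha : 0 < a.re) {x b : ℝ} (hx : 0 < x) (hb : 0 < b) :
    (∫ p in Set.Ioi b, laplaceKernel a x p) + Real.log b + ∫ p in Set.Ioi (0 : ℝ), dirichletKernel a p
      = (∫ p in Set.Ioi b, (laplaceKernel a x p - ((1 + p : ℝ) : ℂ) ^ (-a) / p)) +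
        (∫ p in Set.Ioc 0 b, dirichletKernel a p) + Real.log (1 + b) := by
  have hK := integrableOn_laplaceKernel_Ioi ha hx hb
  have hD := integrableOn_dirichletKernel ha
  have hDb := hD.mono_set (Set.Ioi_subset_Ioi hb.le)
  obtain ⟨hL, eL⟩ := integral_Ioi_one_add_inv_div hb
  have eLc : ∫ p in Set.Ioi b, (((1 + p)⁻¹ / p : ℝ) : ℂ) =
      ((Real.log (1 + b) - Real.log b : ℝ) : ℂ) := by
    rw [← eL]; exact integral_ofReal
  have hLc : IntegrableOn (fun p : ℝ => (((1 + p)⁻¹ / p : ℝ) : ℂ)) (Set.Ioi b) := hL.ofReal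
  -- The comparison term `(1 + p) ^ (-a) / p` is the elementary `(1 + p)⁻¹ / p`, which produces the
  -- logarithms, minus the Dirichlet kernel.
  have hsplit : ∀ p : ℝ, laplaceKernel a x p - ((1 + p : ℝ) : ℂ) ^ (-a) / p =
      laplaceKernel a x p + dirichletKernel a p - (((1 + p)⁻¹ / p : ℝ) : ℂ) := fun p => by
    rw [dirichletKernel, Complex.cpow_neg_one]
    push_cast
    ring
  simp_rw [hsplit]
  rw [integral_sub (by exact hK.add hDb) hLc, integral_add hK hDb, eLc, ← Set.Ioc_union_Ioi_eq_Ioi hb.le,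
    setIntegral_union Set.Ioc_disjoint_Ioi_same measurableSet_Ioi
      (hD.mono_set Set.Ioc_subset_Ioi_self) hDb]
  push_cast
  ring

/-- The base exceeds `1 + p` by `2x + x(1 + x)/p`. In the mean value bound, `(1 + p) ^ (-3/2)` is
replaced by `p ^ (-1/2)` against the first summand and by `1` against the second, so that both tails
over `p > b` are `O(√x)` for `x ≤ 1`. -/
theorem norm_laplaceKernel_sub_le {a : ℂ} (ha : a.re = 1 / 2) {x p : ℝ} (hx : 0 < x) (hp : 0 < p) :
    ‖laplaceKernel a x p - ((1 + p : ℝ) : ℂ) ^ (-a) / p‖ ≤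
      ‖a‖ * (2 * x * p ^ (-(3 / 2) : ℝ) + x * (1 + x) * p ^ (-2 : ℝ)) := by
  have h1 : 0 < 1 + p := by positivity
  have h := norm_ofReal_cpow_neg_sub_le (a := a) (by rw [ha]; norm_num) h1
    (one_add_le_laplaceBase hx hp)
  rw [laplaceKernel, ← sub_div, norm_div, Complex.norm_real, Real.norm_of_nonneg hp.le,
    div_le_iff₀ hp]
  refine h.trans ?_
  have e1 : (1 + p) ^ (-a.re - 1) ≤ p ^ (-(1 / 2) : ℝ) := by
    refine (Real.rpow_le_rpow_of_exponent_le (by linarith) (by rw [ha]; linarith)).trans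
      (Real.rpow_le_rpow_of_nonpos hp (by linarith) (by norm_num))
  have e2 : (1 + p) ^ (-a.re - 1) ≤ 1 :=
    Real.rpow_le_one_of_one_le_of_nonpos (by linarith) (by rw [ha]; norm_num)
  have e3 : p ^ (-(3 / 2) : ℝ) * p = p ^ (-(1 / 2) : ℝ) := by
    rw [← Real.rpow_add_one hp.ne']; norm_num
  have e4 : p ^ (-2 : ℝ) * p = p⁻¹ := by
    rw [← Real.rpow_add_one hp.ne', ← Real.rpow_neg_one]; norm_num
  rw [mul_assoc, mul_assoc]
  refine mul_le_mul_of_nonneg_left ?_ (norm_nonneg a)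
  rw [add_mul, mul_assoc, e3, mul_assoc _ (p ^ (-2 : ℝ)), e4,
    show laplaceBase x p - (1 + p) = 2 * x + x * (1 + x) * p⁻¹ by rw [laplaceBase]; ring, mul_add]
  refine add_le_add ?_ ?_
  · rw [mul_comm]
    exact mul_le_mul_of_nonneg_left e1 (by positivity)
  · exact mul_le_of_le_one_left (by positivity) e2

open MeasureTheory in
theorem norm_integral_laplaceKernel_sub_le {a : ℂ} (ha : a.re = 1 / 2) {x b : ℝ} (hx : 0 < x)
    (hb : 0 < b) :
    ‖∫ p in Set.Ioi b, (laplaceKernel a x p - ((1 + p : ℝ) : ℂ) ^ (-a) / p)‖ ≤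
      ‖a‖ * (4 * x * b ^ (-(1 / 2) : ℝ) + x * (1 + x) / b) := by
  have i1 := integrableOn_Ioi_rpow_of_lt (by norm_num : (-(3 / 2) : ℝ) < -1) hb
  have i2 := integrableOn_Ioi_rpow_of_lt (by norm_num : (-2 : ℝ) < -1) hb
  refine (norm_integral_le_of_norm_le
    (((i1.const_mul (2 * x)).add (i2.const_mul (x * (1 + x)))).const_mul ‖a‖) ?_).trans_eq ?_
  · filter_upwards [ae_restrict_mem measurableSet_Ioi] with p hp
    exact norm_laplaceKernel_sub_le ha hx (hb.trans hp)
  · simp only [Pi.add_apply]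
    rw [integral_const_mul, integral_add (i1.const_mul _) (i2.const_mul _), integral_const_mul,
      integral_const_mul, integral_Ioi_rpow_of_lt (by norm_num) hb,
      integral_Ioi_rpow_of_lt (by norm_num) hb, show (-(3 / 2) + 1 : ℝ) = -(1 / 2) by norm_num,
      show (-2 + 1 : ℝ) = -1 by norm_num, Real.rpow_neg_one]
    ring

open MeasureTheory in
/-- Uniform approximation of Laplace's integral by its logarithmic main term. -/
theorem norm_laplace_integral_add_log_le {a : ℂ} (ha : a.re = 1 / 2) {x : ℝ} (hx : 0 < x) :
    ‖(∫ p in Set.Ioi (0 : ℝ), laplaceKernel a x p) + Real.log x +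
      2 * ∫ p in Set.Ioi (0 : ℝ), dirichletKernel a p‖ ≤ (16 * ‖a‖ + 14) * √x := by
  have ha0 : 0 < a.re := by rw [ha]; norm_num
  rw [integral_laplaceKernel_eq_two_mul ha0 hx]
  set b := √(x * (1 + x)) with hbdef
  have hb : 0 < b := Real.sqrt_pos.2 (by positivity)
  have hb2 : b ^ 2 = x * (1 + x) := Real.sq_sqrt (by positivity)
  have hxb : x ≤ b := Real.le_sqrt_of_sq_le (by nlinarith)
  have hsx : 0 < √x := Real.sqrt_pos.2 hx
  have hsx2 : √x ^ 2 = x := Real.sq_sqrt hx.le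
  have hbx : b ^ (-(1 / 2) : ℝ) ≤ (√x)⁻¹ := by
    refine (Real.rpow_le_rpow_of_nonpos hx hxb (by norm_num)).trans_eq ?_
    rw [Real.rpow_neg hx.le, Real.sqrt_eq_rpow]
  have hna := norm_nonneg a
  -- For `x ≤ 1` the comparison is used, and `b ≤ 2√x`. For `x ≥ 1` no cancellation is needed, as
  -- `√x ≥ 1` absorbs the constants.
  rcases le_total x 1 with hx1 | hx1
  · have hlog : Real.log x = 2 * Real.log b - Real.log (1 + x) := by
      have h := congrArg Real.log hb2
      rw [Real.log_pow, Real.log_mul hx.ne' (by positivity)] at h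
      push_cast at h
      linarith
    have hsx1 : √x ≤ 1 := Real.sqrt_le_one.2 hx1
    have hxs : x ≤ √x := by nlinarith
    have hbs : b ≤ 2 * √x := by
      refine Real.sqrt_le_iff.2 ⟨by positivity, ?_⟩
      rw [mul_pow, hsx2]
      nlinarith
    have key := laplace_integral_add_log ha0 hx hb
    have e : 2 * (∫ p in Set.Ioi b, laplaceKernel a x p) + Real.log x +
        2 * ∫ p in Set.Ioi (0 : ℝ), dirichletKernel a p =
        2 * (∫ p in Set.Ioi b, (laplaceKernel a x p - ((1 + p : ℝ) : ℂ) ^ (-a) / p)) +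
        2 * (∫ p in Set.Ioc 0 b, dirichletKernel a p) +
        ((2 * Real.log (1 + b) - Real.log (1 + x) : ℝ) : ℂ) := by
      rw [hlog, Complex.ofReal_sub, Complex.ofReal_sub, Complex.ofReal_mul, Complex.ofReal_mul,
        Complex.ofReal_ofNat]
      linear_combination 2 * key
    have n1 : ‖∫ p in Set.Ioi b, (laplaceKernel a x p - ((1 + p : ℝ) : ℂ) ^ (-a) / p)‖
        ≤ ‖a‖ * (6 * √x) := by
      refine (norm_integral_laplaceKernel_sub_le ha hx hb).trans ?_
      refine mul_le_mul_of_nonneg_left ?_ hna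
      have h1 : 4 * x * b ^ (-(1 / 2) : ℝ) ≤ 4 * √x := by
        refine (mul_le_mul_of_nonneg_left hbx (by positivity)).trans_eq ?_
        nth_rewrite 1 [← hsx2]
        field_simp
      have h2 : x * (1 + x) / b = b := by rw [← hb2]; field_simp
      rw [h2]
      linarith
    have n2 : ‖∫ p in Set.Ioc 0 b, dirichletKernel a p‖ ≤ (1 + ‖a‖) * (2 * √x) := by
      have h := norm_setIntegral_le_of_norm_le_const (μ := volume) (s := Set.Ioc (0 : ℝ) b)
        (by simp) fun p hp => norm_dirichletKernel_le ha0.le hp.1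
      simp only [Real.volume_real_Ioc_of_le hb.le, sub_zero] at h
      exact h.trans (mul_le_mul_of_nonneg_left hbs (by positivity))
    have n3 : |2 * Real.log (1 + b) - Real.log (1 + x)| ≤ 5 * √x := by
      have l1 : Real.log (1 + b) ≤ b := by linarith [Real.log_le_sub_one_of_pos (by linarith : 0 < 1 + b)]
      have l2 : Real.log (1 + x) ≤ x := by linarith [Real.log_le_sub_one_of_pos (by linarith : 0 < 1 + x)]
      have l3 : 0 ≤ Real.log (1 + b) := Real.log_nonneg (by linarith)
      have l4 : 0 ≤ Real.log (1 + x) := Real.log_nonneg (by linarith)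
      rw [abs_le]
      constructor <;> linarith
    rw [e]
    refine (norm_add₃_le).trans ?_
    rw [norm_mul, norm_mul, Complex.norm_ofNat, Complex.norm_real, Real.norm_eq_abs]
    -- The sum is `12‖a‖√x + 4(1 + ‖a‖)√x + 5√x`, which accounts for the coefficient `16`.
    nlinarith
  · have hsx1 : 1 ≤ √x := Real.one_le_sqrt.2 hx1
    have n1 : ‖∫ p in Set.Ioi b, laplaceKernel a x p‖ ≤ 2 := by
      refine (norm_integral_laplaceKernel_le ha0 hx hb).trans ?_
      rw [ha]
      have : (√x)⁻¹ ≤ 1 := inv_le_one_of_one_le₀ hsx1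
      linarith
    have n2 : |Real.log x| ≤ 2 * √x := by
      rw [abs_of_nonneg (Real.log_nonneg hx1), ← hsx2, Real.log_pow]
      have := Real.log_le_sub_one_of_pos hsx
      rw [Real.sqrt_sq hsx.le]
      push_cast
      linarith
    have n3 := norm_integral_dirichletKernel_le ha0
    rw [ha] at n3
    refine (norm_add₃_le).trans ?_
    rw [norm_mul, norm_mul, Complex.norm_ofNat, Complex.norm_real, Real.norm_eq_abs]
    -- The sum is `4 + 2√x + 2(4 + ‖a‖)`, which accounts for the constant `14`.
    nlinarith

/-! ### The asymptotic formula. -/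

theorem mainTheorem4 :
    ∀ r₀ : ℝ, 0 < r₀ → ∃ C : ℝ, 0 < C ∧ ∀ r : ℝ, r₀ ≤ r → ∀ y : ℝ, 0 < y →
      ‖Complex.Gamma (1 / 2 + Complex.I * r) ^ 2 / Complex.Gamma (1 + 2 * Complex.I * r) *
            gaussF (1 / 2 + Complex.I * r) (1 / 2 + Complex.I * r) (1 + 2 * Complex.I * r) (-y)
          - (y : ℂ) ^ (-(1 / 2) - Complex.I * r) *
            ((Real.log y : ℂ) + 2 * Complex.digamma 1
              - 2 * Complex.digamma (1 / 2 + Complex.I * r))‖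
        ≤ C * (r / y) := by
  intro r₀ hr₀
  -- From `‖a‖ ≤ 1/2 + r`, `16‖a‖ + 14 ≤ 16 r + 22`, and `22 ≤ (22 / r₀) r`.
  refine ⟨16 + 22 / r₀, by positivity, fun r hr y hy => ?_⟩
  have hr0 : 0 < r := hr₀.trans_le hr
  set a : ℂ := 1 / 2 + Complex.I * r with ha
  have hare : a.re = 1 / 2 := by simp [ha]
  have ha0 : 0 < a.re := by rw [hare]; norm_num
  have h2a : (1 : ℂ) + 2 * Complex.I * r = 2 * a := by rw [ha]; ring
  have hna : ‖a‖ ≤ 1 / 2 + r := by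
    refine (norm_add_le _ _).trans (add_le_add ?_ ?_)
    · norm_num
    · rw [norm_mul, Complex.norm_I, one_mul, Complex.norm_real, Real.norm_of_nonneg hr0.le]
  have hx : 0 < y⁻¹ := inv_pos.2 hy
  have hcut : (-y : ℂ) ∈ cutPlane := by
    have h : (1 : ℂ) - -y = ((1 + y : ℝ) : ℂ) := by push_cast; ring
    rw [cutPlane, Set.mem_ofPred_eq, h]
    exact Complex.ofReal_mem_slitPlane.2 (by positivity)
  have hpow : ((y⁻¹ : ℝ) : ℂ) ^ a = (y : ℂ) ^ (-a) := by
    rw [Complex.ofReal_inv, Complex.inv_cpow, Complex.cpow_neg]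
    rw [Complex.arg_ofReal_of_nonneg hy.le]; exact Real.pi_pos.ne
  have hL : Complex.Gamma a ^ 2 / Complex.Gamma (2 * a) * gaussF a a (2 * a) (-y) =
      (y : ℂ) ^ (-a) * ∫ p in Set.Ioi (0 : ℝ), laplaceKernel a y⁻¹ p := by
    have h1 := betaIntegral_mul_gaussF a (b := a) (c := 2 * a) ha0 (by simp [hare]; norm_num) hcut
    have h2 := eulerIntegral_eq_integral_laplaceKernel a hx
    rw [inv_inv] at h2
    rw [← hpow, ← h2, ← h1, show 2 * a - a = a by ring,
      Complex.betaIntegral_eq_Gamma_mul_div _ _ ha0 ha0, two_mul, sq]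
  have hE := norm_laplace_integral_add_log_le hare hx
  rw [integral_dirichletKernel ha0, Real.log_inv] at hE
  rw [h2a, hL, show -(1 / 2) - Complex.I * r = -a by rw [ha]; ring, ← mul_sub, norm_mul,
    Complex.norm_cpow_eq_rpow_re_of_pos hy, Complex.neg_re, hare]
  have hs : y ^ (-(1 / 2) : ℝ) = √y⁻¹ := by
    rw [Real.sqrt_inv, Real.rpow_neg hy.le, Real.sqrt_eq_rpow]
  have hE' : ‖(∫ p in Set.Ioi (0 : ℝ), laplaceKernel a y⁻¹ p) - ((Real.log y : ℂ) +
      2 * Complex.digamma 1 - 2 * Complex.digamma a)‖ ≤ (16 * ‖a‖ + 14) * √y⁻¹ := by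
    refine le_of_eq_of_le (congrArg _ ?_) hE
    push_cast
    ring
  have hC : 16 * ‖a‖ + 14 ≤ (16 + 22 / r₀) * r := by
    have : 22 ≤ 22 / r₀ * r := by
      rw [div_mul_eq_mul_div, le_div_iff₀ hr₀]
      linarith
    linarith
  calc y ^ (-(1 / 2) : ℝ) * _ ≤ √y⁻¹ * ((16 * ‖a‖ + 14) * √y⁻¹) := by
        rw [hs]
        exact mul_le_mul_of_nonneg_left hE' (Real.sqrt_nonneg _)
    _ = (16 * ‖a‖ + 14) * y⁻¹ := by
        nth_rewrite 3 [← Real.mul_self_sqrt hx.le]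
        ring
    _ ≤ (16 + 22 / r₀) * r * y⁻¹ := mul_le_mul_of_nonneg_right hC hx.le
    _ = (16 + 22 / r₀) * (r / y) := by ring
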